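/- All Banach spaces are complex and carry a fixed norm. A class $\mathcal{E}$ of Banach spaces is said to be of type $>1$ if there exist $p>1$ and $T\in\mathbb{R}_+$ such that for every $E\in\mathcal{E}$, every $n\ge 1$ and all $x_1,\dots,x_n\in E$, $$\Big(\mathbb{E}_{\epsilon_i=\pm1}\Big\|\sum_{i=1}^n\epsilon_i x_i\Big\|_E^2\Big)^{1/2}\le T\Big(\sum_{i=1}^n\|x_i\|_E^p\Big)^{1/p}.$$ For a finite set $I$ and a Banach space $E$, let $\ell^2(I,E)$ be the space of functions $f:I\to E$ with the norm $\|f\|=\big(\mathbb{E}_{x\in I}\|f(x)\|_E^2\big)^{1/2}$, where $\mathbb{E}_{x\in I}$ denotes the average over $I$. For a finite abelian group $G$ with group of characters $\hat G$, let $T_G\otimes 1_E:\ell^2(G,E)\to\ell^2(\hat G,E)$ be the operator $(T_G\otimes 1_E)f(\chi)=\mathbb{E}_{x\in G}\,\chi(x)f(x)$. Corollary 2.2. Let $\mathcal{E}$ be a class of Banach spaces of type $>1$. There exist $\varepsilon>0$ and $C\in\mathbb{R}_+$ such that for every finite abelian group $G$ and every Banach space $E$ in $\mathcal{E}$, $$\|T_G\otimes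 1_E\|_{\mathcal{L}(\ell^2(G,E),\,\ell^2(\hat G,E))}\le C\,(\#G)^{-\varepsilon}.$$ -/

import Mathlib

open scoped BigOperators

universe u v w

/-- A class of complex Banach spaces (with their precise norms). -/
def BanachClass : Type (u + 1) :=
  (E : Type u) → [NormedAddCommGroup E] → [NormedSpace ℂ E] → [CompleteSpace E] → Prop

/-- `E` has type `p` with constant `T`:
`(𝔼_{ε_i = ±1} ‖∑ ε_i x_i‖²)^{1/2} ≤ T (∑ ‖x_i‖^p)^{1/p}` for all finite families in `E`. -/
def HasTypeWith (E : Type u) [NormedAddCommGroup E] (p T : ℝ) : Prop :=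
  ∀ n : ℕ, 0 < n → ∀ x : Fin n → E,
    Real.sqrt (𝔼 ε : Fin n → ℤˣ, ‖∑ i, ((ε i : ℤ) • x i)‖ ^ 2) ≤
      T * (∑ i, ‖x i‖ ^ p) ^ (1 / p)

/-- A class of Banach spaces is (uniformly) of type `> 1`: all its members have type `p` with
constant `T`, for some common `p > 1` and `T`. -/
def BanachClass.IsTypeGtOne (𝓔 : BanachClass.{u}) : Prop :=
  ∃ p : ℝ, 1 < p ∧ ∃ T : ℝ, 0 ≤ T ∧
    ∀ (E : Type u) [NormedAddCommGroup E] [NormedSpace ℂ E] [CompleteSpace E],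
      𝓔 E → HasTypeWith E p T

/-- `ℓ²(I, E)`: functions on the finite set `I` with values in `E`, with the averaged norm
`‖f‖ = (𝔼_{i ∈ I} ‖f i‖²)^{1/2}`. -/
def AvgL2 (I : Type v) (E : Type u) : Type (max v u) := I → E

namespace AvgL2

variable {I : Type v} {J : Type w} {E : Type u}

instance [NormedAddCommGroup E] : AddCommGroup (AvgL2 I E) :=
  inferInstanceAs (AddCommGroup (I → E))

instance [NormedAddCommGroup E] [NormedSpace ℂ E] : Module ℂ (AvgL2 I E) :=
  inferInstanceAs (Module ℂ (I → E))

noncomputable instance [Fintype I] [NormedAddCommGroup E] : Norm (AvgL2 I E) :=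
  ⟨fun f => Real.sqrt (𝔼 i : I, ‖f i‖ ^ 2)⟩

theorem norm_def [Fintype I] [NormedAddCommGroup E] (f : AvgL2 I E) :
    ‖f‖ = Real.sqrt (𝔼 i : I, ‖f i‖ ^ 2) := rfl

theorem norm_eq [Fintype I] [NormedAddCommGroup E] (f : AvgL2 I E) :
    ‖f‖ = ‖WithLp.toLp (V := I → E) 2 f‖ / Real.sqrt (Fintype.card I) := by
  rw [norm_def, PiLp.norm_eq_of_L2, Fintype.expect_eq_sum_div_card, Real.sqrt_div']
  positivity

theorem norm_apply_le [Fintype I] [NormedAddCommGroup E] (f : AvgL2 I E) (i : I) :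
    ‖f i‖ ≤ Real.sqrt (Fintype.card I) * ‖f‖ := by
  have h0 : 0 < Real.sqrt (Fintype.card I) :=
    Real.sqrt_pos.2 (by exact_mod_cast Fintype.card_pos_iff.2 ⟨i⟩)
  rw [norm_eq, mul_div_cancel₀ _ h0.ne']
  exact PiLp.norm_apply_le (p := 2) (WithLp.toLp (V := I → E) 2 f) i

theorem norm_le_of_forall [Fintype I] [NormedAddCommGroup E] (f : AvgL2 I E) {c : ℝ}
    (hc : 0 ≤ c) (h : ∀ i, ‖f i‖ ≤ c) : ‖f‖ ≤ c := by
  rw [norm_def]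
  refine Real.sqrt_le_iff.2 ⟨hc, ?_⟩
  rcases isEmpty_or_nonempty I with hI | hI
  · simp only [Finset.univ_eq_empty, Finset.expect_empty]
    positivity
  · exact Finset.expect_le Finset.univ_nonempty fun i _ =>
      pow_le_pow_left₀ (norm_nonneg _) (h i) 2

theorem normedSpaceCore [Fintype I] [NormedAddCommGroup E] [NormedSpace ℂ E] :
    NormedSpace.Core ℂ (AvgL2 I E) where
  norm_nonneg f := Real.sqrt_nonneg _
  norm_smul c f := by
    rw [norm_eq, norm_eq, ← mul_div_assoc, ← norm_smul]
    rfl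
  norm_triangle f g := by
    rw [norm_eq, norm_eq, norm_eq, ← add_div]
    exact div_le_div_of_nonneg_right
      (norm_add_le (WithLp.toLp (V := I → E) 2 f) (WithLp.toLp (V := I → E) 2 g)) (Real.sqrt_nonneg _)
  norm_eq_zero_iff f := by
    constructor
    · intro h
      funext i
      have := norm_apply_le f i
      rw [h, mul_zero] at this
      exact norm_le_zero_iff.1 this
    · rintro rfl
      refine le_antisymm (norm_le_of_forall _ le_rfl fun i => ?_) (Real.sqrt_nonneg _)
      exact norm_zero.le

noncomputable instance [Fintype I] [NormedAddCommGroup E] [NormedSpace ℂ E] :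
    NormedAddCommGroup (AvgL2 I E) :=
  NormedAddCommGroup.ofCore normedSpaceCore

noncomputable instance [Fintype I] [NormedAddCommGroup E] [NormedSpace ℂ E] :
    NormedSpace ℂ (AvgL2 I E) :=
  NormedSpace.ofCore normedSpaceCore

end AvgL2

/-- `A ⊗ 1_E : ℓ²(J, E) → ℓ²(I, E)`, `f ↦ (i ↦ ∑ j, A i j • f j)`, as a bounded operator. -/
noncomputable def tensorOne {I : Type v} {J : Type w} [Fintype I] [Fintype J]
    (A : Matrix I J ℂ) (E : Type u) [NormedAddCommGroup E] [NormedSpace ℂ E] :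
    AvgL2 J E →L[ℂ] AvgL2 I E :=
  LinearMap.mkContinuous
    { toFun := fun f i => ∑ j, A i j • f j
      map_add' := fun f g => by
        funext i
        change ∑ j, A i j • (f j + g j) = ∑ j, A i j • f j + ∑ j, A i j • g j
        simp only [smul_add, Finset.sum_add_distrib]
      map_smul' := fun c f => by
        funext i
        change ∑ j, A i j • (c • f j) = c • ∑ j, A i j • f j
        simp only [Finset.smul_sum, smul_comm c] }
    ((∑ i, ∑ j, ‖A i j‖) * Real.sqrt (Fintype.card J))
    (fun f => by
      refine AvgL2.norm_le_of_forall _ (by positivity) fun i => ?_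
      change ‖∑ j, A i j • f j‖ ≤ _
      calc ‖∑ j, A i j • f j‖ ≤ ∑ j, ‖A i j‖ * (Real.sqrt (Fintype.card J) * ‖f‖) := by
            refine norm_sum_le_of_le _ fun j _ => ?_
            rw [norm_smul]
            exact mul_le_mul_of_nonneg_left (AvgL2.norm_apply_le f j) (norm_nonneg _)
        _ = (∑ j, ‖A i j‖) * (Real.sqrt (Fintype.card J) * ‖f‖) := by rw [Finset.sum_mul]
        _ ≤ (∑ i, ∑ j, ‖A i j‖) * (Real.sqrt (Fintype.card J) * ‖f‖) := by
            refine mul_le_mul_of_nonneg_right ?_ (by positivity)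
            exact Finset.single_le_sum (f := fun i => ∑ j, ‖A i j‖)
              (fun i _ => by positivity) (Finset.mem_univ i)
        _ = _ := by rw [mul_assoc])

theorem tensorOne_apply {I : Type v} {J : Type w} [Fintype I] [Fintype J]
    (A : Matrix I J ℂ) (E : Type u) [NormedAddCommGroup E] [NormedSpace ℂ E]
    (f : AvgL2 J E) (i : I) : tensorOne A E f i = ∑ j, A i j • f j := rfl

/-- The matrix of the Fourier transform `T_G f (χ) = 𝔼_{x ∈ G} χ(x) f(x)` of a finite abelian group
`G`, with rows indexed by the characters of `G` and columns by the elements of `G`. -/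
noncomputable def fourierMatrix (G : Type v) [AddCommGroup G] [Fintype G] :
    Matrix (AddChar G ℂ) G ℂ :=
  fun χ x => (Fintype.card G : ℂ)⁻¹ * χ x

/-! Bounds for the Fourier transform multiply along an extension of `Q` by `K`
(`FourierBound.extension`, the fast Fourier transform). So power decay for all groups follows once
every group of order above some `N` contains a nontrivial subgroup `K` with bound `(#K)^(-ε)`. The
constant must be exactly one there, since constants would also multiply; one then inducts on
quotients, and groups of order at most `N` cost only the factor `N ^ ε`.

Nontrivial bounds come from `exists_strict_contraction`. The trivial bound is 1; if it is nearly
attained on a group of bounded order, some `f` has almost constant norm `m` and every Fourier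
coefficient is almost as large as the triangle inequality permits. If characters realise all sign
patterns `c r + ε r * d r` on `k` points, with `c r` bounded away from modulus one, then all signed
sums of the `d r • f (x r)` have norm at least a fixed multiple of `k * m`. Type `p > 1` forbids
this for large `k`.

This is applied twice. In `ℤ/16^k`, lacunary points give nearly free signs. Powers of the resulting
contraction, with `FourierBound.zmod_of_le` to reach arbitrary orders, give power decay on cyclic
groups. A general large group either has a large cyclic factor, where this decay absorbs its
constant, or has many cyclic factors of bounded order, whose generators carry independent two-valued
choices of characters. -/

/-- The Fourier transform of `G` has norm at most `c` on `ℓ²(G, E)`, in unnormalized form. -/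
def FourierBound (G : Type*) [AddCommGroup G] [Fintype G] (E : Type*) [NormedAddCommGroup E]
    [NormedSpace ℂ E] (c : ℝ) : Prop :=
  ∀ f : G → E, ∑ χ : AddChar G ℂ, ‖∑ x, χ x • f x‖ ^ 2 ≤
    (c * Fintype.card G) ^ 2 * ∑ x, ‖f x‖ ^ 2

/-! ### Trivial bound, isomorphisms and extensions. -/

section

variable {G : Type*} [AddCommGroup G] [Fintype G] {K : Type*} [AddCommGroup K] [Fintype K]
  {Q : Type*} [AddCommGroup Q] [Fintype Q] {E : Type*} [NormedAddCommGroup E] [NormedSpace ℂ E]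

theorem FourierBound.mono {c d : ℝ} (h : FourierBound G E c) (hc : 0 ≤ c) (hcd : c ≤ d) :
    FourierBound G E d := fun f => by
  refine (h f).trans ?_
  gcongr

/-- Cauchy–Schwarz for each of the `#G` unimodular characters; no geometry of `E` is involved. -/
theorem fourierBound_one : FourierBound G E 1 := fun f => by
  have h1 : ∀ χ : AddChar G ℂ, ‖∑ x, χ x • f x‖ ^ 2 ≤ Fintype.card G * ∑ x, ‖f x‖ ^ 2 := by
    intro χ
    calc ‖∑ x, χ x • f x‖ ^ 2 ≤ (∑ x, ‖f x‖) ^ 2 := by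
          gcongr
          refine norm_sum_le_of_le _ fun x _ => ?_
          rw [norm_smul, AddChar.norm_apply, one_mul]
      _ ≤ _ := by
          simpa using sq_sum_le_card_mul_sum_sq (s := (Finset.univ : Finset G)) (f := fun x => ‖f x‖)
  calc _ ≤ ∑ χ : AddChar G ℂ, Fintype.card G * ∑ x, ‖f x‖ ^ 2 :=
        Finset.sum_le_sum fun χ _ => h1 χ
    _ = _ := by
        rw [Finset.sum_const, Finset.card_univ, AddChar.card_eq, nsmul_eq_mul]
        ring

theorem FourierBound.of_addEquiv {c : ℝ} (e : K ≃+ G) (h : FourierBound K E c) :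
    FourierBound G E c := fun f => by
  have h1 := h (fun k => f (e k))
  rw [Fintype.card_congr e.toEquiv, show ∑ k, ‖f (e k)‖ ^ 2 = ∑ x, ‖f x‖ ^ 2 from
    e.toEquiv.sum_comp (fun x => ‖f x‖ ^ 2)] at h1
  refine le_of_eq_of_le ?_ h1
  let φ : AddChar G ℂ ≃ AddChar K ℂ :=
    { toFun := fun χ => χ.compAddMonoidHom e.toAddMonoidHom
      invFun := fun χ => χ.compAddMonoidHom e.symm.toAddMonoidHom
      left_inv := fun χ => by ext; simp
      right_inv := fun χ => by ext; simp }
  refine Fintype.sum_equiv φ _ _ fun χ => ?_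
  congr 2
  exact (e.toEquiv.sum_comp (fun x => χ x • f x)).symm

/-- A character trivial on the kernel of a surjection descends along it. -/
theorem AddChar.exists_comp_eq {G Q : Type*} [AddCommGroup G] [AddCommGroup Q] (π : G →+ Q) (hπ : Function.Surjective π) (χ : AddChar G ℂ)
    (h : ∀ x, π x = 0 → χ x = 1) : ∃ ω : AddChar Q ℂ, ω.compAddMonoidHom π = χ := by
  have key : ∀ x y, π x = π y → χ x = χ y := by
    intro x y hxy
    have := h (x - y) (by rw [map_sub, hxy, sub_self])
    rw [← sub_add_cancel x y, AddChar.map_add_eq_mul, this, one_mul]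
  refine ⟨{ toFun := fun q => χ (Function.surjInv hπ q)
            map_zero_eq_one' := h _ (Function.surjInv_eq hπ 0)
            map_add_eq_mul' := fun a b => ?_ }, ?_⟩
  · rw [← AddChar.map_add_eq_mul]
    apply key
    simp [Function.surjInv_eq]
  · ext x
    exact key _ _ (Function.surjInv_eq hπ _)

/-- The restriction map on characters has fibres of size at most the index. -/
theorem AddChar.sum_comp_le (φ : K →+ G) (π : G →+ Q) (hπ : Function.Surjective π)
    (hex : ∀ x, π x = 0 → ∃ k, φ k = x) (g : AddChar K ℂ → ℝ) (hg : ∀ ψ, 0 ≤ g ψ) :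
    ∑ χ : AddChar G ℂ, g (χ.compAddMonoidHom φ) ≤ Fintype.card Q * ∑ ψ, g ψ := by
  classical
  rw [← Finset.sum_fiberwise (s := Finset.univ)
    (g := fun χ : AddChar G ℂ => χ.compAddMonoidHom φ), Finset.mul_sum]
  refine Finset.sum_le_sum fun ψ _ => ?_
  rw [Finset.sum_congr rfl (g := fun _ => g ψ)
    (fun χ hχ => by rw [(Finset.mem_filter.1 hχ).2]), Finset.sum_const, nsmul_eq_mul]
  refine mul_le_mul_of_nonneg_right ?_ (hg ψ)
  norm_cast
  rcases Finset.eq_empty_or_nonempty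
    ({χ : AddChar G ℂ | χ.compAddMonoidHom φ = ψ} : Finset (AddChar G ℂ)) with h0 | ⟨χ₀, h0⟩
  · simp [h0]
  have h0' := (Finset.mem_filter.1 h0).2
  rw [← AddChar.card_eq (α := Q), ← Finset.card_univ]
  refine (Finset.card_le_card (t := Finset.univ.image
    fun ω : AddChar Q ℂ => χ₀ * ω.compAddMonoidHom π) fun χ hχ => ?_).trans Finset.card_image_le
  have hχ' := (Finset.mem_filter.1 hχ).2
  obtain ⟨ω, hω⟩ := AddChar.exists_comp_eq π hπ (χ₀⁻¹ * χ) (fun x hx => by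
    obtain ⟨k, rfl⟩ := hex x hx
    have h1 : χ (φ k) = χ₀ (φ k) := by
      have := DFunLike.congr_fun (hχ'.trans h0'.symm) k
      simpa using this
    rw [AddChar.mul_apply, h1, ← AddChar.mul_apply]
    simp)
  refine Finset.mem_image.2 ⟨ω, Finset.mem_univ _, ?_⟩
  rw [hω, mul_inv_cancel_left]

/-- The fast Fourier transform: bounds multiply along extensions. -/
theorem FourierBound.extension {c d : ℝ} (φ : K →+ G) (hφ : Function.Injective φ) (π : G →+ Q)
    (hπ : Function.Surjective π) (hex : ∀ x, π x = 0 ↔ ∃ k, φ k = x)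
    (hK : FourierBound K E c) (hQ : FourierBound Q E d) : FourierBound G E (c * d) := by
  classical
  intro f
  let s := Function.surjInv hπ
  have hs : ∀ q, π (s q) = q := Function.surjInv_eq hπ
  have hπφ : ∀ k, π (φ k) = 0 := fun k => (hex _).2 ⟨k, rfl⟩
  let e : Q × K ≃ G := Equiv.ofBijective (fun a => s a.1 + φ a.2) (by
    constructor
    · rintro ⟨q, k⟩ ⟨q', k'⟩ h
      have h' : s q + φ k = s q' + φ k' := h
      have hq : q = q' := by simpa [hs, hπφ] using congrArg π h'
      subst hq
      rw [hφ (add_left_cancel h')]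
    · intro x
      obtain ⟨k, hk⟩ := (hex (x - s (π x))).1 (by simp [hs])
      exact ⟨(π x, k), by simp [hk]⟩)
  have hsum : ∀ (F : G → E), ∑ x, F x = ∑ q, ∑ k, F (s q + φ k) := by
    intro F
    rw [← e.sum_comp F, Fintype.sum_prod_type]
    rfl
  have hsumR : ∀ (F : G → ℝ), ∑ x, F x = ∑ q, ∑ k, F (s q + φ k) := by
    intro F
    rw [← e.sum_comp F, Fintype.sum_prod_type]
    rfl
  have hcard : (Fintype.card G : ℝ) = Fintype.card Q * Fintype.card K := by
    rw [← Fintype.card_congr e, Fintype.card_prod]; push_cast; ring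
  have hQ0 : (0 : ℝ) < Fintype.card Q := by exact_mod_cast Fintype.card_pos
  let g : Q → AddChar K ℂ → E := fun q ψ => ∑ k, ψ k • f (s q + φ k)
  have hT : ∀ (χ : AddChar G ℂ) (ω : AddChar Q ℂ),
      ∑ x, (χ * ω.compAddMonoidHom π) x • f x =
        ∑ q, ω q • (χ (s q) • g q (χ.compAddMonoidHom φ)) := by
    intro χ ω
    rw [hsum]
    refine Finset.sum_congr rfl fun q _ => ?_
    simp only [g, Finset.smul_sum, smul_smul]
    refine Finset.sum_congr rfl fun k _ => ?_
    simp only [AddChar.mul_apply, AddChar.compAddMonoidHom_apply, hs, hπφ,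
      AddChar.map_add_eq_mul, AddChar.map_zero_eq_one]
    congr 1
    ring
  -- Twisting by `ω ∘ π` permutes the characters of `G` and does not change their restriction to
  -- `K`. For fixed `χ` the sum over `ω` is therefore a transform on `Q`. The factor `χ (s q)`,
  -- present because the section `s` need not be additive, is unimodular and drops out of norms.
  have havg : (Fintype.card Q : ℝ) * ∑ χ : AddChar G ℂ, ‖∑ x, χ x • f x‖ ^ 2 =
      ∑ χ : AddChar G ℂ, ∑ ω : AddChar Q ℂ,
        ‖∑ q, ω q • (χ (s q) • g q (χ.compAddMonoidHom φ))‖ ^ 2 := by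
    rw [Finset.sum_comm, ← AddChar.card_eq (α := Q), ← nsmul_eq_mul, ← Finset.card_univ,
      ← Finset.sum_const]
    refine Finset.sum_congr rfl fun ω _ => ?_
    rw [← Equiv.sum_comp (Equiv.mulRight (ω.compAddMonoidHom π))
      (fun χ : AddChar G ℂ => ‖∑ x, χ x • f x‖ ^ 2)]
    refine Finset.sum_congr rfl fun χ _ => ?_
    rw [← hT]
    rfl
  have hbound : (Fintype.card Q : ℝ) * ∑ χ : AddChar G ℂ, ‖∑ x, χ x • f x‖ ^ 2 ≤
      Fintype.card Q * ((c * d * Fintype.card G) ^ 2 * ∑ x, ‖f x‖ ^ 2) := by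
    rw [havg]
    calc _ ≤ ∑ χ : AddChar G ℂ, (d * Fintype.card Q) ^ 2 *
            ∑ q, ‖g q (χ.compAddMonoidHom φ)‖ ^ 2 := by
          refine Finset.sum_le_sum fun χ _ => (hQ _).trans_eq ?_
          simp only [norm_smul, AddChar.norm_apply, one_mul]
      _ ≤ Fintype.card Q * ∑ ψ, (d * Fintype.card Q) ^ 2 * ∑ q, ‖g q ψ‖ ^ 2 :=
          AddChar.sum_comp_le φ π hπ (fun x => (hex x).1)
            (fun ψ => (d * Fintype.card Q) ^ 2 * ∑ q, ‖g q ψ‖ ^ 2) (fun ψ => by positivity)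
      _ = Fintype.card Q * ((d * Fintype.card Q) ^ 2 * ∑ q, ∑ ψ, ‖g q ψ‖ ^ 2) := by
          rw [← Finset.mul_sum, Finset.sum_comm]
      _ ≤ Fintype.card Q * ((d * Fintype.card Q) ^ 2 *
            ∑ q, (c * Fintype.card K) ^ 2 * ∑ k, ‖f (s q + φ k)‖ ^ 2) := by
          gcongr with q
          exact hK _
      _ = _ := by
          rw [hsumR (fun x => ‖f x‖ ^ 2), hcard, ← Finset.mul_sum]
          ring
  exact le_of_mul_le_mul_left hbound hQ0

theorem FourierBound.opNorm_le {c : ℝ} (hc : 0 ≤ c) (h : FourierBound G E c) :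
    ‖tensorOne (fourierMatrix G) E‖ ≤ c := by
  refine ContinuousLinearMap.opNorm_le_bound _ hc fun f => ?_
  have hn : (0 : ℝ) < Fintype.card G := by exact_mod_cast Fintype.card_pos
  change Real.sqrt _ ≤ c * Real.sqrt _
  rw [Real.sqrt_le_left (by positivity), mul_pow, Real.sq_sqrt (by
      refine Finset.expect_nonneg fun i _ => by positivity),
    Fintype.expect_eq_sum_div_card, Fintype.expect_eq_sum_div_card, AddChar.card_eq,
    ← mul_div_assoc]
  gcongr
  have h1 := h f
  have h2 : ∀ χ : AddChar G ℂ, ‖tensorOne (fourierMatrix G) E f χ‖ ^ 2 =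
      ((Fintype.card G : ℝ) ^ 2)⁻¹ * ‖∑ x, χ x • f x‖ ^ 2 := by
    intro χ
    rw [tensorOne_apply]
    simp only [fourierMatrix, mul_smul]
    rw [← Finset.smul_sum, norm_smul, mul_pow]
    simp
  rw [Finset.sum_congr rfl fun χ _ => h2 χ, ← Finset.mul_sum, inv_mul_le_iff₀ (by positivity)]
  linarith [h1]

end

/-! ### Near-extremal functions. -/

section

variable {G : Type*} [AddCommGroup G] [Fintype G] {E : Type*} [NormedAddCommGroup E]
  [NormedSpace ℂ E]

/-- A function almost extremal for the Fourier transform has almost constant norm, and all its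
Fourier coefficients are almost as large as possible. -/
theorem exists_almost_constant_norm {N δ : ℝ} (hN : Fintype.card G ≤ N) (hδ : 0 < δ) (hδ1 : δ ≤ 1)
    (h : ¬ FourierBound G E (1 - (δ / (2 * N)) ^ 2)) :
    ∃ f : G → E, ∃ m : ℝ, 0 < m ∧ (∀ x, ‖f x‖ ≤ m * (1 + δ)) ∧
      ∀ χ : AddChar G ℂ, Fintype.card G * m - δ * m ≤ ‖∑ x, χ x • f x‖ := by
  classical
  simp only [FourierBound, not_forall, not_le] at h
  obtain ⟨f, hf⟩ := h
  set n : ℝ := (Fintype.card G : ℝ) with hn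
  set S : ℝ := ∑ x, ‖f x‖ ^ 2 with hS
  set A : ℝ := ∑ x, ‖f x‖ with hA
  set η : ℝ := (δ / (2 * N)) ^ 2 with hη
  have hn1 : 1 ≤ n := by rw [hn]; exact_mod_cast Fintype.card_pos
  have hN1 : 1 ≤ N := hn1.trans hN
  have hS0 : 0 ≤ S := Finset.sum_nonneg fun _ _ => by positivity
  have hA0 : 0 ≤ A := Finset.sum_nonneg fun _ _ => by positivity
  have hAS : A ^ 2 ≤ n * S := by
    simpa using sq_sum_le_card_mul_sum_sq (s := (Finset.univ : Finset G)) (f := fun x => ‖f x‖)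
  have hTA : ∀ χ : AddChar G ℂ, ‖∑ x, χ x • f x‖ ≤ A := fun χ =>
    norm_sum_le_of_le _ fun x _ => by rw [norm_smul, AddChar.norm_apply, one_mul]
  have hη0 : 0 ≤ η := by positivity
  have hηn : 4 * η * n ^ 2 ≤ δ ^ 2 := by
    have : 4 * η * N ^ 2 = δ ^ 2 := by rw [hη]; field_simp; norm_num
    rw [← this]; gcongr
  have hηn1 : 2 * η * n ≤ 1 / 2 := by nlinarith
  have hSpos : 0 < S := by
    rcases hS0.eq_or_lt with h0 | h0
    · exfalso
      rw [← h0, mul_zero] at hf hAS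
      have hA' : A = 0 := by nlinarith
      refine hf.not_ge (Finset.sum_nonpos fun χ _ => ?_)
      have := hTA χ
      rw [hA'] at this
      have := le_antisymm this (norm_nonneg _)
      rw [this]; norm_num
    · exact h0
  -- The coefficients have total square above `((1 - η) * n) ^ 2 * S` and each is at most `n * S`;
  -- removing the other `n - 1` leaves a lower bound for any single one.
  have hlow : ∀ χ : AddChar G ℂ, n * S * (1 - 2 * η * n) < ‖∑ x, χ x • f x‖ ^ 2 := by
    intro χ
    rw [← Finset.add_sum_erase _ _ (Finset.mem_univ χ)] at hf
    have h2 : ∑ ψ ∈ Finset.univ.erase χ, ‖∑ x, ψ x • f x‖ ^ 2 ≤ (n - 1) * (n * S) := by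
      calc _ ≤ ∑ ψ ∈ Finset.univ.erase χ, n * S := by
            refine Finset.sum_le_sum fun ψ _ => le_trans ?_ hAS
            gcongr
            exact hTA ψ
        _ = _ := by
            rw [Finset.sum_const, Finset.card_erase_of_mem (Finset.mem_univ χ), Finset.card_univ,
              AddChar.card_eq, nsmul_eq_mul, Nat.cast_sub Fintype.card_pos, Nat.cast_one]
    have h3 : (1 - 2 * η) * (n ^ 2 * S) ≤ ((1 - η) * n) ^ 2 * S := by
      have : 0 ≤ η ^ 2 * (n ^ 2 * S) := by positivity
      nlinarith
    nlinarith
  have hlowA : n * S * (1 - 2 * η * n) < A ^ 2 :=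
    (hlow 0).trans_le (by gcongr; exact hTA 0)
  have hApos : 0 < A := by
    have : 0 < n * S * (1 - 2 * η * n) := by
      have : 0 < 1 - 2 * η * n := by linarith
      positivity
    nlinarith
  set m : ℝ := A / n with hm
  have hnm : A = n * m := by rw [hm]; field_simp
  have hmpos : 0 < m := by positivity
  have hS2 : S ≤ 2 * n * m ^ 2 := by
    rw [hnm] at hlowA
    have : n * S * (1 / 2) ≤ n * S * (1 - 2 * η * n) := by gcongr; linarith
    have h4 : n * S ≤ n * (2 * n * m ^ 2) := by nlinarith
    exact le_of_mul_le_mul_left h4 (by linarith)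
  -- The left side is `S - n * m ^ 2`, the defect in Cauchy–Schwarz, which `hlowA` makes small.
  have hvar : ∑ x, (‖f x‖ - m) ^ 2 ≤ (δ * m) ^ 2 := by
    have h5 : ∑ x, (‖f x‖ - m) ^ 2 = S - n * m ^ 2 := by
      have : ∀ x, (‖f x‖ - m) ^ 2 = ‖f x‖ ^ 2 - 2 * m * ‖f x‖ + m ^ 2 := fun x => by ring
      simp only [this, Finset.sum_add_distrib, Finset.sum_sub_distrib, ← Finset.mul_sum,
        Finset.sum_const, Finset.card_univ, nsmul_eq_mul]
      rw [← hA, ← hS, hnm]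
      ring
    rw [h5]
    have h6 : n * (S - n * m ^ 2) ≤ n * (2 * η * n * S) := by
      rw [hnm] at hlowA
      nlinarith
    have h7 := le_of_mul_le_mul_left h6 (by linarith)
    calc _ ≤ 2 * η * n * S := h7
      _ ≤ 2 * η * n * (2 * n * m ^ 2) := by gcongr
      _ = 4 * η * n ^ 2 * m ^ 2 := by ring
      _ ≤ δ ^ 2 * m ^ 2 := by gcongr
      _ = _ := by ring
  refine ⟨f, m, hmpos, fun x => ?_, fun χ => ?_⟩
  · have h8 : (‖f x‖ - m) ^ 2 ≤ (δ * m) ^ 2 :=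
      (Finset.single_le_sum (f := fun x => (‖f x‖ - m) ^ 2) (fun x _ => by positivity)
        (Finset.mem_univ x)).trans hvar
    have := abs_le_of_sq_le_sq' h8 (by positivity)
    linarith [this.2]
  · have h9 : (n * m) ^ 2 * (1 - 2 * η * n) ≤ ‖∑ x, χ x • f x‖ ^ 2 := by
      rw [← hnm]
      refine le_trans ?_ (hlow χ).le
      gcongr
      linarith
    refine le_of_sq_le_sq ?_ (norm_nonneg _)
    refine le_trans ?_ h9
    have h10 : 2 * η * n * n ≤ δ / 2 := by nlinarith
    have h11 : n * (n * m ^ 2) * (2 * η * n) ≤ n * m ^ 2 * (δ / 2) := by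
      have : 0 ≤ n * m ^ 2 := by positivity
      nlinarith
    have h12 : δ ^ 2 * m ^ 2 ≤ n * m ^ 2 * δ := by
      have : δ ^ 2 ≤ n * δ := by nlinarith
      calc δ ^ 2 * m ^ 2 ≤ n * δ * m ^ 2 := by gcongr
        _ = _ := by ring
    have h13 : 0 ≤ n * m ^ 2 * δ := by positivity
    linarith

end

/-! ### Type `p` and strict contraction. -/

theorem exists_nat_mul_rpow_lt {p a b : ℝ} (hp : 1 < p) (hb : 0 < b) :
    ∃ k : ℕ, 0 < k ∧ a * (k : ℝ) ^ (1 / p) < b * k := by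
  have h1 : 0 < 1 - 1 / p := by
    rw [sub_pos, div_lt_one (by linarith)]; exact hp
  have h2 := ((tendsto_rpow_atTop h1).comp tendsto_natCast_atTop_atTop).eventually_gt_atTop (a / b)
  obtain ⟨k, hk, hk0⟩ := (h2.and (Filter.eventually_gt_atTop 0)).exists
  refine ⟨k, hk0, ?_⟩
  have hk' : (0 : ℝ) < k := by exact_mod_cast hk0
  simp only [Function.comp] at hk
  rw [div_lt_iff₀ hb] at hk
  calc a * (k : ℝ) ^ (1 / p) < (k : ℝ) ^ (1 - 1 / p) * b * (k : ℝ) ^ (1 / p) := by gcongr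
    _ = b * ((k : ℝ) ^ (1 - 1 / p) * (k : ℝ) ^ (1 / p)) := by ring
    _ = b * k := by rw [← Real.rpow_add hk']; simp

/-- In a space of type `p`, some signed sum of `k` vectors of norm at most `b` is smaller than
`T b k ^ (1 / p)`. -/
theorem HasTypeWith.exists_le {E : Type u} [NormedAddCommGroup E] {p T : ℝ}
    (h : HasTypeWith E p T) (hp : 1 < p) (hT : 0 ≤ T) {k : ℕ} (hk : 0 < k) (x : Fin k → E)
    {b a : ℝ} (hb : 0 ≤ b) (hx : ∀ r, ‖x r‖ ≤ b) (ha : 0 ≤ a)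
    (hlow : ∀ ε : Fin k → ℤˣ, a ≤ ‖∑ r, ((ε r : ℤ) • x r)‖) : a ≤ T * (b * (k : ℝ) ^ (1 / p)) := by
  have hp0 : 0 < p := by linarith
  calc a ≤ Real.sqrt (𝔼 ε : Fin k → ℤˣ, ‖∑ i, ((ε i : ℤ) • x i)‖ ^ 2) := by
        refine Real.le_sqrt_of_sq_le ?_
        exact Finset.le_expect Finset.univ_nonempty fun ε _ => by
          have := hlow ε
          gcongr
    _ ≤ _ := h k hk x
    _ ≤ T * (∑ _r : Fin k, b ^ p) ^ (1 / p) := by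
        gcongr with r
        exact hx r
    _ = _ := by
        rw [Finset.sum_const, Finset.card_univ, Fintype.card_fin, nsmul_eq_mul,
          Real.mul_rpow (by positivity) (by positivity), ← Real.rpow_mul hb,
          mul_one_div_cancel hp0.ne', Real.rpow_one]
        ring

/-- If `k` elements of a group of bounded size carry characters with sufficiently independent
values, the Fourier transform is a uniform strict contraction on spaces of type `p`. -/
theorem exists_strict_contraction {p T κ : ℝ} (hp : 1 < p) (hT : 0 ≤ T) (hκ : 0 < κ)
    (hκ1 : κ ≤ 1) : ∃ k : ℕ, 0 < k ∧ ∀ N : ℕ, 0 < N → ∃ η : ℝ, 0 < η ∧ η < 1 ∧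
      ∀ (G : Type v) [AddCommGroup G] [Fintype G] (E : Type u) [NormedAddCommGroup E]
        [NormedSpace ℂ E], HasTypeWith E p T → Fintype.card G ≤ N →
        ∀ x : Fin k → G, Function.Injective x → ∀ c d : Fin k → ℂ, (∀ r, ‖d r‖ ≤ 1) →
        (∀ ε : Fin k → ℤˣ, ∃ χ : AddChar G ℂ, ∀ r,
          ‖χ (x r) - (c r + ((ε r : ℤ) : ℂ) * d r)‖ + ‖c r‖ ≤ 1 - κ) →
        FourierBound G E (1 - η) := by
  classical
  -- The signed sums will be at least `k * κ * m / 2`, while type gives at most `T * (2 * m) * k ^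
  -- (1 / p)`: hence `4 * T`. Here `k` does not depend on the order of the group.
  obtain ⟨k, hk0, hk⟩ := exists_nat_mul_rpow_lt (a := 4 * T) hp hκ
  refine ⟨k, hk0, fun N hN => ?_⟩
  have hN' : (1 : ℝ) ≤ N := by exact_mod_cast hN
  have hk1 : (1 : ℝ) ≤ k := by exact_mod_cast hk0
  -- The accumulated error will be at most `δ * m * (1 + N + k)`, made equal to half of `κ * m`.
  set δ : ℝ := κ / (2 * (1 + N + k)) with hδ
  have hδκ : δ * (1 + N + k) = κ / 2 := by rw [hδ]; field_simp
  have hδ0 : 0 < δ := by positivity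
  have hδ1 : δ ≤ 1 := by nlinarith
  refine ⟨(δ / (2 * N)) ^ 2, by positivity, ?_, ?_⟩
  · have : δ / (2 * N) < 1 := by rw [div_lt_one (by positivity)]; linarith
    exact pow_lt_one₀ (by positivity) this two_ne_zero
  intro G _ _ E _ _ hE hcard x hx c d hd hχ
  by_contra hcon
  have hcard' : (Fintype.card G : ℝ) ≤ N := by exact_mod_cast hcard
  obtain ⟨f, m, hm, hfm, hlow⟩ := exists_almost_constant_norm hcard' hδ0 hδ1 hcon
  set n : ℝ := (Fintype.card G : ℝ) with hn
  have hkn : (k : ℝ) ≤ n := by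
    rw [hn]; exact_mod_cast (by simpa using Fintype.card_le_of_injective x hx)
  have main := hE.exists_le hp hT hk0 (fun r => d r • f (x r)) (b := 2 * m) (a := k * κ * m / 2)
    (by positivity) (fun r => ?_) (by positivity) (fun ε => ?_)
  · have : k * κ * m / 2 ≤ (4 * T * (k : ℝ) ^ (1 / p)) * (m / 2) := by
      refine main.trans_eq ?_; ring
    nlinarith
  · rw [norm_smul]
    calc ‖d r‖ * ‖f (x r)‖ ≤ 1 * (m * (1 + δ)) := by
          gcongr
          exacts [hd r, hfm _]
      _ ≤ 2 * m := by nlinarith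
  · obtain ⟨χ, hχ⟩ := hχ ε
    have h1 := hlow χ
    -- After the sign part is removed, the coefficients at the `k` points have modulus at most `1 -
    -- κ`. The rest of the sum thus falls short of `n * m` by about `k * κ * m`, which the signed
    -- sum must supply.
    have hsplit : ∑ y, χ y • f y =
        ∑ r, ((ε r : ℤ) • (d r • f (x r))) +
          ∑ r, (χ (x r) - ((ε r : ℤ) : ℂ) * d r) • f (x r) +
          ∑ y ∈ Finset.univ \ Finset.univ.image x, χ y • f y := by
      rw [← Finset.sum_sdiff (Finset.subset_univ (Finset.univ.image x)), add_comm,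
        Finset.sum_image hx.injOn, ← Finset.sum_add_distrib]
      congr 1
      refine Finset.sum_congr rfl fun r _ => ?_
      rw [← Int.cast_smul_eq_zsmul ℂ, smul_smul, ← add_smul]
      congr 1
      ring
    have h2 : ‖∑ r, (χ (x r) - ((ε r : ℤ) : ℂ) * d r) • f (x r)‖ ≤
        k * ((1 - κ) * (m * (1 + δ))) := by
      have : ∀ r ∈ (Finset.univ : Finset (Fin k)),
          ‖(χ (x r) - ((ε r : ℤ) : ℂ) * d r) • f (x r)‖ ≤ (1 - κ) * (m * (1 + δ)) := by
        intro r _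
        rw [norm_smul]
        have h3 : ‖χ (x r) - ((ε r : ℤ) : ℂ) * d r‖ ≤ 1 - κ := by
          refine le_trans ?_ (hχ r)
          refine le_trans (le_of_eq ?_) (norm_add_le _ _)
          congr 1
          ring
        have := hfm (x r)
        gcongr
      simpa using norm_sum_le_of_le _ this
    have h4 : ‖∑ y ∈ Finset.univ \ Finset.univ.image x, χ y • f y‖ ≤ (n - k) * (m * (1 + δ)) := by
      have : ∀ y ∈ Finset.univ \ Finset.univ.image x, ‖χ y • f y‖ ≤ m * (1 + δ) := fun y _ => by
        rw [norm_smul, AddChar.norm_apply, one_mul]; exact hfm y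
      refine (norm_sum_le_of_le _ this).trans_eq ?_
      rw [Finset.sum_const, Finset.card_univ_sdiff, Finset.card_image_of_injective _ hx,
        Finset.card_univ, Fintype.card_fin, nsmul_eq_mul, Nat.cast_sub]
      simpa using Fintype.card_le_of_injective x hx
    have h5 := (norm_add₃_le).trans' (hsplit ▸ h1)
    have h6 : n * m - δ * m - k * ((1 - κ) * (m * (1 + δ))) - (n - k) * (m * (1 + δ)) ≤
      ‖∑ r, ((ε r : ℤ) • (d r • f (x r)))‖ := by linarith
    refine le_trans ?_ h6
    have h7 : k * ((1 - κ) * (m * (1 + δ))) ≤ k * (1 - κ) * m + k * (m * δ) := by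
      have : 0 ≤ k * (κ * (m * δ)) := by positivity
      nlinarith
    have h8 : (n - k) * (m * (1 + δ)) ≤ (n - k) * m + N * (m * δ) := by
      have : 0 ≤ m * δ := by positivity
      nlinarith
    have h9 : δ * m * (1 + N + k) = κ / 2 * m := by rw [← hδκ]; ring
    have h10 : κ / 2 * m ≤ k * (κ / 2 * m) := le_mul_of_one_le_left (by positivity) hk1
    nlinarith

/-! ### Cyclic groups. -/

section

variable {E : Type*} [NormedAddCommGroup E] [NormedSpace ℂ E]

/-- Integer representatives in `[0, n)` make frequencies of cyclic groups of different orders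
comparable. -/
theorem fourierBound_zmod_iff {n : ℕ} [NeZero n] {c : ℝ} :
    FourierBound (ZMod n) E c ↔ ∀ f : Fin n → E,
      ∑ y : Fin n, ‖∑ x : Fin n, Complex.exp (2 * Real.pi * Complex.I * (x * y / n)) • f x‖ ^ 2 ≤
        (c * n) ^ 2 * ∑ x, ‖f x‖ ^ 2 := by
  let e : Fin n ≃ ZMod n := (ZMod.finEquiv n).toEquiv
  have he : ∀ x : Fin n, e x = ((x : ℕ) : ZMod n) := by
    intro x
    obtain _ | n := n
    · exact x.elim0
    · exact (Fin.cast_val_eq_self x).symm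
  let X : ZMod n ≃ AddChar (ZMod n) ℂ :=
    Equiv.ofBijective (fun y => (ZMod.stdAddChar (N := n)).mulShift y) (by
      rw [Fintype.bijective_iff_injective_and_card, AddChar.card_eq]
      refine ⟨fun a b hab => ?_, rfl⟩
      have := DFunLike.congr_fun hab 1
      simp only [AddChar.mulShift_apply, mul_one] at this
      exact ZMod.injective_stdAddChar this)
  have hX : ∀ x y : Fin n, X (e y) (e x) =
      Complex.exp (2 * Real.pi * Complex.I * (x * y / n)) := by
    intro x y
    change ZMod.stdAddChar (e y * e x) = _
    rw [he, he]
    have := ZMod.stdAddChar_coe (N := n) (((y : ℕ) * (x : ℕ) : ℕ) : ℤ)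
    push_cast at this
    rw [this]
    congr 1
    ring
  have key : ∀ f : ZMod n → E, ∑ χ : AddChar (ZMod n) ℂ, ‖∑ x, χ x • f x‖ ^ 2 =
      ∑ y : Fin n, ‖∑ x : Fin n,
        Complex.exp (2 * Real.pi * Complex.I * (x * y / n)) • f (e x)‖ ^ 2 := by
    intro f
    rw [← (e.trans X).sum_comp]
    refine Finset.sum_congr rfl fun y _ => ?_
    rw [← e.sum_comp]
    simp only [Equiv.trans_apply, hX]
  constructor
  · intro h f
    have := h (fun x => f (e.symm x))
    rw [key, ← e.sum_comp (fun x => ‖f (e.symm x)‖ ^ 2), ZMod.card] at this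
    simpa using this
  · intro h f
    rw [key, ← e.sum_comp (fun x => ‖f x‖ ^ 2), ZMod.card]
    exact h _

theorem hasSum_exp_mul_smul_sum {ι : Type*} [Fintype ι] (a : ℂ) (t s : ι → ℂ) (g : ι → E) :
    HasSum (fun m : ℕ => (a ^ m / m.factorial) • ∑ x, (t x * s x) ^ m • g x)
      (∑ x, Complex.exp (a * (t x * s x)) • g x) := by
  simp only [Finset.smul_sum]
  refine hasSum_sum fun x _ => ?_
  have := (NormedSpace.expSeries_div_hasSum_exp (a * (t x * s x))).smul_const (g x)
  rw [← Complex.exp_eq_exp_ℂ] at this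
  convert! this using 2 with m
  rw [smul_smul, mul_pow]
  congr 1
  ring

/-- The Fourier transform of `ℤ/n` is controlled by that of a larger cyclic group. -/
theorem FourierBound.zmod_of_le {n N : ℕ} [NeZero n] [NeZero N] (hnN : n ≤ N) {c : ℝ} (hc : 0 ≤ c)
    (h : FourierBound (ZMod N) E c) :
    FourierBound (ZMod n) E (c * Real.exp (2 * Real.pi) * (N / n)) := by
  classical
  rw [fourierBound_zmod_iff] at h ⊢
  intro f
  have hn0 : 0 < n := Nat.pos_of_ne_zero (NeZero.ne n)
  have hN0 : 0 < N := Nat.pos_of_ne_zero (NeZero.ne N)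
  have hn0' : (0 : ℝ) < n := by exact_mod_cast hn0
  have hN0' : (0 : ℝ) < N := by exact_mod_cast hN0
  have hnC : (n : ℂ) ≠ 0 := by exact_mod_cast hn0.ne'
  have hNC : (N : ℂ) ≠ 0 := by exact_mod_cast hN0.ne'
  -- Round `x * N / n` down. The remainder `t x` lies in `[0, 1]`, and the kernel becomes that of
  -- `ℤ/N` times `exp (a * (t x * s y))`, with `s y = y / N` also in `[0, 1]`.
  let φ : Fin n → Fin N := fun x => ⟨x * N / n, by
    rw [Nat.div_lt_iff_lt_mul hn0, mul_comm]; exact Nat.mul_lt_mul_of_pos_left x.2 hN0⟩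
  have hφ : Function.Injective φ := by
    intro x y hxy
    have h0 : (x * N / n : ℕ) = y * N / n := congrArg Fin.val hxy
    have h1 := Nat.div_add_mod (x * N) n
    have h2 := Nat.div_add_mod (y * N) n
    have h3 := Nat.mod_lt (x * N) hn0
    have h4 := Nat.mod_lt (y * N) hn0
    rw [h0] at h1
    ext
    by_contra hne
    rcases Nat.lt_or_gt_of_ne hne with hlt | hlt
    · have : ((x : ℕ) + 1) * N ≤ (y : ℕ) * N := Nat.mul_le_mul_right N hlt
      rw [add_mul, one_mul] at this
      omega
    · have : ((y : ℕ) + 1) * N ≤ (x : ℕ) * N := Nat.mul_le_mul_right N hlt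
      rw [add_mul, one_mul] at this
      omega
  let t : Fin n → ℝ := fun x => ((x * N % n : ℕ) : ℝ) / n
  have ht0 : ∀ x, 0 ≤ t x := fun x => by positivity
  have ht1 : ∀ x, t x ≤ 1 := fun x => by
    have : ((x * N % n : ℕ) : ℝ) ≤ n := by exact_mod_cast (Nat.mod_lt (x * N) hn0).le
    exact div_le_one_of_le₀ this hn0'.le
  have htφ : ∀ x : Fin n, (x : ℂ) / n = ((φ x : ℕ) : ℂ) / N + t x / N := by
    intro x
    have h1 : ((n * (x * N / n) + x * N % n : ℕ) : ℂ) = ((x * N : ℕ) : ℂ) := by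
      rw [Nat.div_add_mod]
    simp only [t, φ]
    push_cast at h1 ⊢
    field_simp
    linear_combination -h1
  let s : Fin n → ℝ := fun y => (y : ℝ) / N
  have hs0 : ∀ y, 0 ≤ s y := fun y => by positivity
  have hs1 : ∀ y, s y ≤ 1 := fun y => by
    have : ((y : ℕ) : ℝ) ≤ N := by exact_mod_cast y.2.le.trans hnN
    exact div_le_one_of_le₀ this hN0'.le
  let a : ℂ := 2 * Real.pi * Complex.I
  have ha : ‖a‖ = 2 * Real.pi := by simp [a, abs_of_pos Real.pi_pos]
  let F : Fin n → Fin n → E := fun y x => Complex.exp (a * ((φ x : ℕ) * (y : ℕ) / N)) • f x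
  let V : Fin n → E := fun y => ∑ x : Fin n, Complex.exp (a * (x * y / n)) • f x
  have hV : V = fun y => ∑ x, Complex.exp (a * ((t x : ℂ) * (s y : ℂ))) • F y x := by
    funext y
    refine Finset.sum_congr rfl fun x _ => ?_
    simp only [F]
    rw [smul_smul, ← Complex.exp_add]
    congr 2
    have h1 := htφ x
    simp only [s]
    push_cast
    calc a * (x * y / n) = a * y * (x / n) := by ring
      _ = _ := by rw [h1]; ring
  -- The power series separates the variables: each term is the transform of `ℤ/N` between
  -- multipliers `t x ^ m` and `s y ^ m` of modulus at most one. Summing the coefficients gives `exp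
  -- (2π)`.
  let W : ℕ → Fin n → E := fun m y =>
    (a ^ m / m.factorial) • ∑ x, ((t x : ℂ) * (s y : ℂ)) ^ m • F y x
  have hW : HasSum W V := by
    rw [Pi.hasSum, hV]
    exact fun y => hasSum_exp_mul_smul_sum a (fun x => (t x : ℂ)) (fun _ => (s y : ℂ)) (F y)
  have hW2 : HasSum (fun m => WithLp.toLp 2 (W m)) (WithLp.toLp 2 V) :=
    hW.map (WithLp.linearEquiv 2 ℂ (Fin n → E)).symm (PiLp.continuous_toLp 2 _)
  have hWn : ∀ m, ‖WithLp.toLp 2 (W m)‖ ≤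
      ((2 * Real.pi) ^ m / m.factorial) * (c * N * ‖WithLp.toLp 2 f‖) := by
    intro m
    let g : Fin N → E := fun z => ∑ x, if φ x = z then ((t x : ℂ) ^ m) • f x else 0
    have hgφ : ∀ x, g (φ x) = ((t x : ℂ) ^ m) • f x := by
      intro x
      simp only [g, hφ.eq_iff, Finset.sum_ite_eq', Finset.mem_univ, if_true]
    have hg0 : ∀ z, z ∉ Finset.univ.image φ → g z = 0 := by
      intro z hz
      refine Finset.sum_eq_zero fun x _ => if_neg ?_
      rintro rfl
      exact hz (Finset.mem_image_of_mem _ (Finset.mem_univ x))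
    have hgn : ∑ z, ‖g z‖ ^ 2 ≤ ∑ x, ‖f x‖ ^ 2 := by
      rw [← Finset.sum_subset (Finset.subset_univ (Finset.univ.image φ))
        (fun z _ hz => by rw [hg0 z hz]; simp), Finset.sum_image hφ.injOn]
      refine Finset.sum_le_sum fun x _ => ?_
      rw [hgφ, norm_smul, norm_pow, Complex.norm_real, Real.norm_of_nonneg (ht0 x)]
      have : t x ^ m ≤ 1 := pow_le_one₀ (ht0 x) (ht1 x)
      have : t x ^ m * ‖f x‖ ≤ ‖f x‖ := mul_le_of_le_one_left (norm_nonneg _) this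
      have h0 := ht0 x
      gcongr
    have hgs : ∀ y : Fin n, ∑ z : Fin N, Complex.exp (a * (z * ((y : ℕ) : ℂ) / N)) • g z =
        ∑ x, (t x : ℂ) ^ m • F y x := by
      intro y
      rw [← Finset.sum_subset (Finset.subset_univ (Finset.univ.image φ))
        (fun z _ hz => by rw [hg0 z hz, smul_zero]), Finset.sum_image hφ.injOn]
      refine Finset.sum_congr rfl fun x _ => ?_
      rw [hgφ, smul_comm]
    have hy : ∀ y, ‖W m y‖ ≤ ((2 * Real.pi) ^ m / m.factorial) *
        ‖∑ z : Fin N, Complex.exp (a * (z * ((Fin.castLE hnN y : ℕ) : ℂ) / N)) • g z‖ := by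
      intro y
      rw [Fin.val_castLE, hgs]
      have : W m y = (a ^ m / m.factorial) • ((s y : ℂ) ^ m • ∑ x, (t x : ℂ) ^ m • F y x) := by
        simp only [W, Finset.smul_sum, smul_smul]
        refine Finset.sum_congr rfl fun x _ => ?_
        congr 1
        ring
      rw [this, norm_smul, norm_smul, norm_div, norm_pow, ha, norm_pow, Complex.norm_real,
        Real.norm_of_nonneg (hs0 y), Complex.norm_natCast]
      gcongr
      exact mul_le_of_le_one_left (norm_nonneg _) (pow_le_one₀ (hs0 y) (hs1 y))
    rw [PiLp.norm_eq_of_L2, PiLp.norm_eq_of_L2]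
    refine Real.sqrt_le_iff.2 ⟨by positivity, ?_⟩
    calc ∑ y, ‖W m y‖ ^ 2 ≤ ∑ y : Fin n, (((2 * Real.pi) ^ m / m.factorial) *
        ‖∑ z : Fin N, Complex.exp (a * (z * ((Fin.castLE hnN y : ℕ) : ℂ) / N)) • g z‖) ^ 2 := by
          gcongr with y
          exact hy y
      _ = ((2 * Real.pi) ^ m / m.factorial) ^ 2 * ∑ y : Fin n,
        ‖∑ z : Fin N, Complex.exp (a * (z * ((Fin.castLE hnN y : ℕ) : ℂ) / N)) • g z‖ ^ 2 := by
          rw [Finset.mul_sum]; simp only [mul_pow]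
      _ ≤ ((2 * Real.pi) ^ m / m.factorial) ^ 2 * ∑ y : Fin N,
        ‖∑ z : Fin N, Complex.exp (a * (z * ((y : ℕ) : ℂ) / N)) • g z‖ ^ 2 := by
          gcongr
          rw [← Finset.sum_image (f := fun y : Fin N =>
            ‖∑ z : Fin N, Complex.exp (a * (z * ((y : ℕ) : ℂ) / N)) • g z‖ ^ 2)
            (s := Finset.univ) (g := Fin.castLE hnN) (Fin.castLE_injective hnN).injOn]
          exact Finset.sum_le_sum_of_subset_of_nonneg (Finset.subset_univ _)
            fun _ _ _ => by positivity
      _ ≤ ((2 * Real.pi) ^ m / m.factorial) ^ 2 * ((c * N) ^ 2 * ∑ x, ‖f x‖ ^ 2) := by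
          gcongr
          exact (h g).trans (by gcongr)
      _ = _ := by
          rw [mul_pow _ (_ * _), mul_pow (c * N), Real.sq_sqrt (by positivity)]
  have hexp : HasSum (fun m : ℕ => ((2 * Real.pi) ^ m / m.factorial) *
      (c * N * ‖WithLp.toLp 2 f‖)) (Real.exp (2 * Real.pi) * (c * N * ‖WithLp.toLp 2 f‖)) := by
    have := (NormedSpace.expSeries_div_hasSum_exp (2 * Real.pi)).mul_right
      (c * N * ‖WithLp.toLp 2 f‖)
    rwa [← Real.exp_eq_exp_ℝ] at this
  have hfin := hW2.norm_le_of_bounded hexp hWn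
  have hfin2 : ‖WithLp.toLp 2 V‖ ^ 2 ≤
      (Real.exp (2 * Real.pi) * (c * N * ‖WithLp.toLp 2 f‖)) ^ 2 := by gcongr
  rw [PiLp.norm_sq_eq_of_L2, mul_pow, mul_pow (c * N), PiLp.norm_sq_eq_of_L2] at hfin2
  refine hfin2.trans_eq ?_
  have : c * Real.exp (2 * Real.pi) * (N / n) * n = Real.exp (2 * Real.pi) * (c * N) := by
    field_simp
  rw [this, mul_pow]
  change _ * (_ * ∑ x, ‖f x‖ ^ 2) = _
  ring

end

/-- Multiplication by `b` embeds `ZMod a` in `ZMod (a * b)` as the kernel of reduction modulo `b`.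
-/
theorem FourierBound.zmod_mul {E : Type*} [NormedAddCommGroup E] [NormedSpace ℂ E] {a b : ℕ}
    [NeZero a] [NeZero b] {c d : ℝ} (ha : FourierBound (ZMod a) E c)
    (hb : FourierBound (ZMod b) E d) : FourierBound (ZMod (a * b)) E (c * d) := by
  have hb0 : 0 < b := Nat.pos_of_ne_zero (NeZero.ne b)
  let φ : ZMod a →+ ZMod (a * b) := ZMod.lift a ⟨zmultiplesHom (ZMod (a * b)) (b : ZMod (a * b)), by
    rw [zmultiplesHom_apply, zsmul_eq_mul]
    have := ZMod.natCast_self (a * b)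
    push_cast at this ⊢
    exact this⟩
  have hφ : ∀ m : ℕ, φ (m : ZMod a) = ((m * b : ℕ) : ZMod (a * b)) := by
    intro m
    have := ZMod.lift_coe (n := a) ⟨zmultiplesHom (ZMod (a * b)) (b : ZMod (a * b)), by
      rw [zmultiplesHom_apply, zsmul_eq_mul]
      have := ZMod.natCast_self (a * b)
      push_cast at this ⊢
      exact this⟩ (m : ℤ)
    simpa using this
  refine FourierBound.extension φ ?_ (ZMod.castHom (dvd_mul_left b a) (ZMod b)).toAddMonoidHom
    (ZMod.castHom_surjective (dvd_mul_left b a)) ?_ ha hb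
  · rw [injective_iff_map_eq_zero]
    intro x hx
    rw [← ZMod.natCast_zmod_val x, hφ, ZMod.natCast_eq_zero_iff] at hx
    rw [← ZMod.natCast_zmod_val x, ZMod.natCast_eq_zero_iff]
    exact Nat.dvd_of_mul_dvd_mul_right hb0 hx
  · intro x
    have hx : (ZMod.castHom (dvd_mul_left b a) (ZMod b)).toAddMonoidHom x = ((x.val : ℕ) : ZMod b) := by
      conv_lhs => rw [← ZMod.natCast_zmod_val x]
      exact map_natCast (ZMod.castHom (dvd_mul_left b a) (ZMod b)) _
    rw [hx, ZMod.natCast_eq_zero_iff]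
    constructor
    · rintro ⟨m, hm⟩
      refine ⟨(m : ZMod a), ?_⟩
      rw [hφ, Nat.mul_comm m b, ← hm, ZMod.natCast_zmod_val]
    · rintro ⟨k, rfl⟩
      rw [← ZMod.natCast_zmod_val k, hφ, ZMod.val_natCast]
      exact (Nat.dvd_mod_iff (dvd_mul_left b a)).2 (dvd_mul_left b _)

theorem FourierBound.zmod_pow {E : Type*} [NormedAddCommGroup E] [NormedSpace ℂ E] {a : ℕ}
    [NeZero a] {c : ℝ} (ha : FourierBound (ZMod a) E c) (j : ℕ) :
    FourierBound (ZMod (a ^ j)) E (c ^ j) := by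
  induction j with
  | zero => simpa using fourierBound_one
  | succ j ih =>
    rw [pow_succ c]
    exact (ih.zmod_mul ha).of_addEquiv (ZMod.ringEquivCongr (pow_succ a j).symm).toAddEquiv

/-- Lacunary elements of `ℤ/16^k` carry characters with almost arbitrary signs. -/
theorem exists_addChar_lacunary {k : ℕ} (ε : Fin k → ℤˣ) :
    ∃ χ : AddChar (ZMod (16 ^ k)) ℂ, ∀ r : Fin k,
      ‖χ ((16 ^ (k - 1 - (r : ℕ)) : ℕ) : ZMod (16 ^ k)) - ((ε r : ℤ) : ℂ)‖ ≤ 1 / 2 := by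
  -- Base 16 digits of the frequency: digit 8 at place `r` is half a turn, so a sign `-1`, at the
  -- point `16 ^ (k - 1 - r)`. There higher digits give whole turns and lower digits less than a
  -- sixteenth of a turn, the angle `θ`.
  let D : ℕ → ℕ := fun s => if h : s < k then (if ε ⟨s, h⟩ = 1 then 0 else 8) else 0
  have hD : ∀ s, D s ≤ 8 := by intro s; simp only [D]; split_ifs <;> simp
  let Y : ℕ → ℕ := fun r => ∑ s ∈ Finset.range r, D s * 16 ^ s
  have hY : ∀ r, Y r < 16 ^ r := by
    intro r
    induction r with
    | zero => simp [Y]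
    | succ r ih =>
      have h1 : Y (r + 1) = Y r + D r * 16 ^ r := Finset.sum_range_succ _ _
      rw [h1, pow_succ]
      have := Nat.mul_le_mul_right (16 ^ r) (hD r)
      linarith
  have hsplit : ∀ r, r ≤ k → ∃ w, Y k = Y r + 16 ^ r * w := by
    intro r hr
    refine ⟨∑ s ∈ Finset.range (k - r), D (r + s) * 16 ^ s, ?_⟩
    have := Finset.sum_range_add (fun s => D s * 16 ^ s) r (k - r)
    rw [Nat.add_sub_cancel' hr] at this
    simp only [Y]
    rw [this, Finset.mul_sum]
    congr 1
    refine Finset.sum_congr rfl fun s _ => ?_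
    rw [pow_add]; ring
  refine ⟨(ZMod.stdAddChar (N := 16 ^ k)).mulShift ((Y k : ℕ) : ZMod (16 ^ k)), fun r => ?_⟩
  obtain ⟨r, hr⟩ := r
  obtain ⟨w, hw⟩ := hsplit (r + 1) hr
  have hYr : Y (r + 1) = Y r + D r * 16 ^ r := Finset.sum_range_succ _ _
  set θ : ℝ := 2 * Real.pi * (Y r / 16 ^ (r + 1)) with hθ
  have hθ0 : 0 ≤ θ := by positivity
  have hθ1 : θ ≤ 1 / 2 := by
    have h1 : (Y r : ℝ) / 16 ^ (r + 1) ≤ 1 / 16 := by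
      rw [div_le_div_iff₀ (by positivity) (by norm_num), pow_succ]
      have : (Y r : ℝ) ≤ 16 ^ r := by exact_mod_cast (hY r).le
      linarith
    have := Real.pi_lt_d2
    have := Real.pi_pos
    rw [hθ]
    nlinarith
  have hval : (ZMod.stdAddChar (N := 16 ^ k)).mulShift ((Y k : ℕ) : ZMod (16 ^ k))
      ((16 ^ (k - 1 - r) : ℕ) : ZMod (16 ^ k)) =
      ((ε ⟨r, hr⟩ : ℤ) : ℂ) * Complex.exp (Complex.I * θ) := by
    rw [AddChar.mulShift_apply]
    have h1 := ZMod.stdAddChar_coe (N := 16 ^ k) ((Y k * 16 ^ (k - 1 - r) : ℕ) : ℤ)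
    push_cast at h1 ⊢
    rw [h1]
    have h2 : ((16 : ℂ) ^ k) = 16 ^ (k - 1 - r) * 16 ^ (r + 1) := by
      rw [← pow_add]; congr 1; omega
    have h3 : 2 * (Real.pi : ℂ) * Complex.I * ((Y k : ℂ) * 16 ^ (k - 1 - r)) / 16 ^ k =
        Complex.I * θ + (D r / 8 : ℂ) * (Real.pi * Complex.I) + w * (2 * Real.pi * Complex.I) := by
      rw [h2, hw, hYr, hθ]
      push_cast
      field_simp
      ring
    rw [h3, Complex.exp_add, Complex.exp_add, Complex.exp_nat_mul_two_pi_mul_I, mul_one, mul_comm]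
    congr 1
    simp only [D, dif_pos hr]
    rcases Int.units_eq_one_or (ε ⟨r, hr⟩) with h | h
    · simp [h]
    · have : ((-1 : ℤˣ) = 1) = False := by simp
      simp [h, this, Complex.exp_pi_mul_I]
  rw [hval]
  have h4 : ((ε ⟨r, hr⟩ : ℤ) : ℂ) * Complex.exp (Complex.I * θ) - ((ε ⟨r, hr⟩ : ℤ) : ℂ) =
      ((ε ⟨r, hr⟩ : ℤ) : ℂ) * (Complex.exp (Complex.I * θ) - 1) := by ring
  have h5 : ‖((ε ⟨r, hr⟩ : ℤ) : ℂ)‖ = 1 := by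
    rcases Int.units_eq_one_or (ε ⟨r, hr⟩) with h | h <;> simp [h]
  rw [h4, norm_mul, h5, one_mul]
  refine Real.norm_exp_I_mul_ofReal_sub_one_le.trans ?_
  rwa [Real.norm_of_nonneg hθ0]

/-- Converts a contraction on groups of order at most `N` into a power of the order. -/
theorem one_sub_eq_rpow_neg {N η : ℝ} (hN : 1 < N) (h0 : 0 < η) (h1 : η < 1) :
    ∃ ε : ℝ, 0 < ε ∧ N ^ (-ε) = 1 - η := by
  refine ⟨-Real.logb N (1 - η), ?_, ?_⟩
  · rw [neg_pos]
    exact Real.logb_neg hN (by linarith) (by linarith)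
  · rw [neg_neg, Real.rpow_logb (by linarith) hN.ne' (by linarith)]

/-- Power decay of the Fourier transform on cyclic groups. -/
theorem exists_fourierBound_zmod {p T : ℝ} (hp : 1 < p) (hT : 0 ≤ T) :
    ∃ ε : ℝ, 0 < ε ∧ ∃ C : ℝ, 0 < C ∧ ∀ (E : Type u) [NormedAddCommGroup E] [NormedSpace ℂ E],
      HasTypeWith E p T → ∀ (n : ℕ) [NeZero n], FourierBound (ZMod n) E (C * (n : ℝ) ^ (-ε)) := by
  obtain ⟨k, hk, h⟩ := exists_strict_contraction.{u, 0} hp hT (κ := 1 / 2) (by norm_num)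
    (by norm_num)
  obtain ⟨η, hη0, hη1, h⟩ := h (16 ^ k) (by positivity)
  set Q : ℕ := 16 ^ k with hQ
  have hQ1 : 1 < Q := Nat.one_lt_pow hk.ne' (by norm_num)
  have hQ1' : (1 : ℝ) < Q := by exact_mod_cast hQ1
  have hQ0' : (0 : ℝ) < Q := by linarith
  have : NeZero Q := ⟨by omega⟩
  obtain ⟨ε, hε0, hQε⟩ := one_sub_eq_rpow_neg hQ1' hη0 hη1
  -- The factor `exp (2π)` comes from changing the order, and `Q` from rounding `n` up to a power of
  -- `Q`.
  refine ⟨ε, hε0, Real.exp (2 * Real.pi) * Q, by positivity, fun E _ _ hE n _ => ?_⟩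
  have hn0 : 0 < n := Nat.pos_of_ne_zero (NeZero.ne n)
  have hn0' : (0 : ℝ) < n := by exact_mod_cast hn0
  have hcontr : FourierBound (ZMod Q) E (1 - η) := by
    refine h (ZMod Q) E hE (by rw [ZMod.card])
      (fun r => ((16 ^ (k - 1 - (r : ℕ)) : ℕ) : ZMod Q)) ?_ (fun _ => 0) (fun _ => 1) (by simp) ?_
    · intro r s hrs
      have hlt : ∀ r : Fin k, 16 ^ (k - 1 - (r : ℕ)) < Q := fun r =>
        Nat.pow_lt_pow_right (by norm_num) (by omega)
      have h1 := congrArg ZMod.val hrs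
      simp only [ZMod.val_natCast, Nat.mod_eq_of_lt (hlt _)] at h1
      have := Nat.pow_right_injective (by norm_num) h1
      ext
      omega
    · intro s
      obtain ⟨χ, hχ⟩ := exists_addChar_lacunary s
      refine ⟨χ, fun r => ?_⟩
      have := hχ r
      simp only [zero_add, mul_one, norm_zero, add_zero]
      linarith
  set j : ℕ := Nat.clog Q n with hj
  have hnj : n ≤ Q ^ j := Nat.le_pow_clog hQ1 n
  have hnj' : (n : ℝ) ≤ (Q : ℝ) ^ j := by exact_mod_cast hnj
  have hjn : (Q : ℝ) ^ j ≤ Q * n := by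
    rcases Nat.lt_or_ge 1 n with h1 | h1
    · have h2 : Q ^ (j - 1) < n := Nat.pow_pred_clog_lt_self hQ1 h1
      have h3 : 0 < j := Nat.clog_pos hQ1 h1
      have h4 : Q ^ j = Q * Q ^ (j - 1) := by
        rw [← pow_succ']; congr 1; omega
      have h5 : Q ^ j ≤ Q * n := by rw [h4]; exact Nat.mul_le_mul_left Q h2.le
      exact_mod_cast h5
    · have h2 : n = 1 := by omega
      have h3 : j = 0 := by rw [hj, h2]; simp
      rw [h3, h2]; simpa using hQ1'.le
  have hη' : (0 : ℝ) ≤ (1 - η) ^ j := pow_nonneg (by linarith) j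
  have hfin := FourierBound.zmod_of_le hnj hη' (hcontr.zmod_pow j)
  refine hfin.mono (by positivity) ?_
  have hpow : (1 - η) ^ j ≤ (n : ℝ) ^ (-ε) := by
    rw [← hQε, ← Real.rpow_natCast, ← Real.rpow_mul hQ0'.le, mul_comm, Real.rpow_mul hQ0'.le,
      Real.rpow_natCast]
    exact Real.rpow_le_rpow_of_nonpos hn0' hnj' (by linarith)
  have hQn : ((Q ^ j : ℕ) : ℝ) / n ≤ Q := by
    rw [div_le_iff₀ hn0']
    exact_mod_cast hjn
  calc (1 - η) ^ j * Real.exp (2 * Real.pi) * (((Q ^ j : ℕ) : ℝ) / n) ≤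
        (n : ℝ) ^ (-ε) * Real.exp (2 * Real.pi) * Q := by gcongr
    _ = _ := by ring

/-! ### Products of cyclic groups of bounded order. -/

/-- Strict convexity of the disc: the midpoint of two distinct unimodular numbers lies inside it. -/
theorem norm_one_add_stdAddChar_lt {n : ℕ} [NeZero n] (hn : 1 < n) :
    ‖(1 + ZMod.stdAddChar (1 : ZMod n)) / 2‖ < 1 := by
  have := Fact.mk hn
  set ω : ℂ := ZMod.stdAddChar (1 : ZMod n) with hω
  have h1 : ‖ω‖ = 1 := AddChar.norm_apply _ _
  have h2 : ω ≠ 1 := fun h => one_ne_zero (α := ZMod n) (ZMod.injective_stdAddChar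
    (by rw [← hω, h, AddChar.map_zero_eq_one]))
  have h3 := parallelogram_law_with_norm ℝ (1 : ℂ) ω
  have h4 : 0 < ‖1 - ω‖ := norm_pos_iff.2 (sub_ne_zero.2 h2.symm)
  rw [norm_div, Complex.norm_ofNat, div_lt_one two_pos]
  rw [norm_one, h1] at h3
  nlinarith [norm_nonneg (1 + ω)]

/-- Only finitely many orders occur. The cutoff is essential, since the gap closes as `n` grows. -/
theorem exists_uniform_gap (n₀ : ℕ) : ∃ κ : ℝ, 0 < κ ∧ κ ≤ 1 ∧ ∀ (n : ℕ) [NeZero n], 1 < n →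
    n < n₀ → ‖(1 + ZMod.stdAddChar (1 : ZMod n)) / 2‖ ≤ 1 - κ := by
  induction n₀ with
  | zero => exact ⟨1, one_pos, le_rfl, fun n _ _ h => absurd h (Nat.not_lt_zero n)⟩
  | succ m ih =>
    obtain ⟨κ, h0, h1, h⟩ := ih
    by_cases hm : 1 < m
    · have : NeZero m := ⟨by omega⟩
      have hlt := norm_one_add_stdAddChar_lt hm
      refine ⟨min κ (1 - ‖(1 + ZMod.stdAddChar (1 : ZMod m)) / 2‖), lt_min h0 (by linarith),
        (min_le_left _ _).trans h1, fun n _ hn hnm => ?_⟩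
      rcases Nat.lt_succ_iff_lt_or_eq.1 hnm with h' | h'
      · have := h n hn h'
        linarith [min_le_left κ (1 - ‖(1 + ZMod.stdAddChar (1 : ZMod m)) / 2‖)]
      · subst h'
        linarith [min_le_right κ (1 - ‖(1 + ZMod.stdAddChar (1 : ZMod n)) / 2‖)]
    · exact ⟨κ, h0, h1, fun n _ hn hnm => absurd hn (by omega)⟩

/-- On `∏ ℤ/n_r`, the values of a character at the standard generators can be prescribed. -/
theorem exists_addChar_pi {k : ℕ} (n : Fin k → ℕ) [∀ r, NeZero (n r)] (ε : Fin k → ℤˣ) :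
    ∃ χ : AddChar (∀ r, ZMod (n r)) ℂ, ∀ r, χ (Pi.single r 1) =
      (1 + ZMod.stdAddChar (1 : ZMod (n r))) / 2 +
        ((ε r : ℤ) : ℂ) * ((1 - ZMod.stdAddChar (1 : ZMod (n r))) / 2) := by
  classical
  -- At the generator these two characters take the values `1` and `ω`, that is `(1 + ω) / 2 ± (1 -
  -- ω) / 2`.
  let ψ : ∀ r, AddChar (ZMod (n r)) ℂ := fun r => if ε r = 1 then 1 else ZMod.stdAddChar
  refine ⟨{ toFun := fun z => ∏ r, ψ r (z r)
            map_zero_eq_one' := by simp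
            map_add_eq_mul' := fun a b => by
              simp [AddChar.map_add_eq_mul, Finset.prod_mul_distrib] }, fun r => ?_⟩
  change ∏ s, ψ s ((Pi.single r 1 : ∀ r, ZMod (n r)) s) = _
  rw [Finset.prod_eq_single r (fun s _ hs => by rw [Pi.single_eq_of_ne hs]; simp) (by simp),
    Pi.single_eq_same]
  simp only [ψ]
  rcases Int.units_eq_one_or (ε r) with h | h
  · simp only [h, if_true, AddChar.one_apply, Units.val_one, Int.cast_one]
    ring
  · have : ((-1 : ℤˣ) = 1) = False := by simp
    simp only [h, this, if_false, Units.val_neg, Units.val_one, Int.cast_neg, Int.cast_one]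
    ring

/-! ### General finite abelian groups. -/

/-- Every large finite abelian group has a nontrivial subgroup whose Fourier transform has power
decay with constant one. -/
theorem exists_subgroup_fourierBound {p T : ℝ} (hp : 1 < p) (hT : 0 ≤ T) :
    ∃ ε : ℝ, 0 < ε ∧ ∃ N : ℕ, 0 < N ∧ ∀ (E : Type u) [NormedAddCommGroup E] [NormedSpace ℂ E],
      HasTypeWith E p T → ∀ (G : Type v) [AddCommGroup G] [Fintype G], N < Fintype.card G →
        ∃ (K : Type) (_ : AddCommGroup K) (_ : Fintype K) (φ : K →+ G), Function.Injective φ ∧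
          1 < Fintype.card K ∧ FourierBound K E ((Fintype.card K : ℝ) ^ (-ε)) := by
  classical
  obtain ⟨ε₁, hε₁, C, hC, hcyc⟩ := exists_fourierBound_zmod.{u} hp hT
  -- Beyond `n₀`, half of the exponent absorbs the constant `C`.
  obtain ⟨n₀, hn₀, hCn₀⟩ : ∃ n₀ : ℕ, 1 < n₀ ∧ ∀ n : ℕ, n₀ ≤ n → C ≤ (n : ℝ) ^ (ε₁ / 2) := by
    have h1 := ((tendsto_rpow_atTop (half_pos hε₁)).comp
      tendsto_natCast_atTop_atTop).eventually_ge_atTop C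
    obtain ⟨n₁, hn₁⟩ := Filter.eventually_atTop.1 h1
    exact ⟨max n₁ 2, by simp, fun n hn => hn₁ n ((le_max_left _ _).trans hn)⟩
  obtain ⟨κ, hκ0, hκ1, hκ⟩ := exists_uniform_gap n₀
  obtain ⟨k, hk, h⟩ := exists_strict_contraction.{u, 0} hp hT hκ0 hκ1
  obtain ⟨η, hη0, hη1, h⟩ := h (n₀ ^ k) (by positivity)
  have hN1 : 1 < n₀ ^ k := Nat.one_lt_pow hk.ne' hn₀
  obtain ⟨ε₂, hε₂, hη⟩ := one_sub_eq_rpow_neg (N := ((n₀ ^ k : ℕ) : ℝ)) (by exact_mod_cast hN1)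
    hη0 hη1
  refine ⟨min (ε₁ / 2) ε₂, lt_min (half_pos hε₁) hε₂, n₀ ^ k, by positivity, ?_⟩
  intro E _ _ hE G _ _ hG
  obtain ⟨ι, _, n, hn, ⟨e⟩⟩ := AddCommGroup.equiv_directSum_zmod_of_finite' G
  have : ∀ i, NeZero (n i) := fun i => ⟨by have := hn i; omega⟩
  have : ∀ i, Fact (1 < n i) := fun i => ⟨hn i⟩
  let e' : G ≃+ ∀ i, ZMod (n i) := e.trans (DirectSum.addEquivProd _)
  by_cases hbig : ∃ i, n₀ ≤ n i
  · obtain ⟨i, hi⟩ := hbig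
    refine ⟨ZMod (n i), inferInstance, inferInstance,
      e'.symm.toAddMonoidHom.comp (AddMonoidHom.single (fun i => ZMod (n i)) i),
      e'.symm.injective.comp (Pi.single_injective (M := fun i => ZMod (n i)) i), by rw [ZMod.card]; exact hn i, ?_⟩
    rw [ZMod.card]
    have hni : (1 : ℝ) ≤ n i := by exact_mod_cast (hn i).le
    refine (hcyc E hE (n i)).mono (by positivity) ?_
    calc C * (n i : ℝ) ^ (-ε₁) ≤ (n i : ℝ) ^ (ε₁ / 2) * (n i : ℝ) ^ (-ε₁) := by
          gcongr
          exact hCn₀ _ hi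
      _ = (n i : ℝ) ^ (-(ε₁ / 2)) := by
          rw [← Real.rpow_add (by linarith)]; congr 1; ring
      _ ≤ _ := Real.rpow_le_rpow_of_exponent_le hni (neg_le_neg (min_le_left _ _))
  · push Not at hbig
    have hcardG : Fintype.card G ≤ n₀ ^ Fintype.card ι := by
      rw [Fintype.card_congr e'.toEquiv, Fintype.card_pi, ← Finset.card_univ,
        ← Finset.prod_const]
      exact Finset.prod_le_prod' fun i _ => by rw [ZMod.card]; exact (hbig i).le
    have hkι : k ≤ Fintype.card ι :=
      ((Nat.pow_lt_pow_iff_right hn₀).1 (hG.trans_le hcardG)).le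
    obtain ⟨j⟩ : Nonempty (Fin k ↪ ι) := Function.Embedding.nonempty_of_card_le (by simpa using hkι)
    let K := ∀ r : Fin k, ZMod (n (j r))
    let φ₀ : K →+ ∀ i, ZMod (n i) :=
      ∑ r, (AddMonoidHom.single (fun i => ZMod (n i)) (j r)).comp (Pi.evalAddMonoidHom _ r)
    have hφ₀ : ∀ (z : K) (r : Fin k), φ₀ z (j r) = z r := by
      intro z r
      simp only [φ₀, AddMonoidHom.finsetSum_apply, AddMonoidHom.comp_apply, Finset.sum_apply]
      rw [Finset.sum_eq_single r]
      · exact Pi.single_eq_same (M := fun i => ZMod (n i)) (j r) (z r)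
      · intro s _ hs
        exact Pi.single_eq_of_ne (fun h => hs (j.injective h).symm) _
      · simp
    have hinj : Function.Injective φ₀ := fun a b hab => by
      funext r
      rw [← hφ₀ a r, ← hφ₀ b r, hab]
    have hKcard : Fintype.card K ≤ n₀ ^ k := by
      rw [Fintype.card_pi]
      calc ∏ r : Fin k, Fintype.card (ZMod (n (j r))) ≤ ∏ _r : Fin k, n₀ :=
            Finset.prod_le_prod' fun r _ => by rw [ZMod.card]; exact (hbig _).le
        _ = _ := by simp
    have hne : ∀ r : Fin k, (Pi.single r 1 : K) ≠ 0 := fun r h0 => by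
      have := congrFun h0 r
      simp at this
    have hK1 : 1 < Fintype.card K :=
      Fintype.one_lt_card_iff.2 ⟨Pi.single ⟨0, hk⟩ 1, 0, hne _⟩
    refine ⟨K, inferInstance, inferInstance, e'.symm.toAddMonoidHom.comp φ₀,
      e'.symm.injective.comp hinj, hK1, ?_⟩
    have hK1' : (1 : ℝ) ≤ Fintype.card K := by exact_mod_cast hK1.le
    have hcontr : FourierBound K E (1 - η) := by
      refine h K E hE hKcard (fun r => Pi.single r 1) ?_
        (fun r => (1 + ZMod.stdAddChar (1 : ZMod (n (j r)))) / 2)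
        (fun r => (1 - ZMod.stdAddChar (1 : ZMod (n (j r)))) / 2) ?_ ?_
      · intro r s hrs
        by_contra hne
        have := congrFun hrs r
        simp [Pi.single_eq_of_ne hne] at this
      · intro r
        rw [norm_div, Complex.norm_ofNat, div_le_one two_pos]
        refine (norm_sub_le _ _).trans ?_
        rw [norm_one, AddChar.norm_apply]
        norm_num
      · intro s
        obtain ⟨χ, hχ⟩ := exists_addChar_pi (fun r => n (j r)) s
        refine ⟨χ, fun r => ?_⟩
        rw [hχ r, sub_self, norm_zero, zero_add]
        exact hκ _ (hn _) (hbig _)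
    refine hcontr.mono (by linarith) ?_
    -- The exponent `ε₂` was defined by `(n₀ ^ k) ^ (-ε₂) = 1 - η`, and `#K` is at most `n₀ ^ k`.
    rw [← hη]
    calc ((n₀ ^ k : ℕ) : ℝ) ^ (-ε₂) ≤ (Fintype.card K : ℝ) ^ (-ε₂) :=
          Real.rpow_le_rpow_of_nonpos (by linarith) (by exact_mod_cast hKcard) (by linarith)
      _ ≤ _ := Real.rpow_le_rpow_of_exponent_le hK1' (neg_le_neg (min_le_right _ _))

/-- Power decay of the Fourier transform of finite abelian groups on spaces of type `p > 1`. -/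
theorem exists_fourierBound {p T : ℝ} (hp : 1 < p) (hT : 0 ≤ T) :
    ∃ ε : ℝ, 0 < ε ∧ ∃ C : ℝ, 0 ≤ C ∧ ∀ (E : Type u) [NormedAddCommGroup E] [NormedSpace ℂ E],
      HasTypeWith E p T → ∀ (G : Type v) [AddCommGroup G] [Fintype G],
        FourierBound G E (C * (Fintype.card G : ℝ) ^ (-ε)) := by
  obtain ⟨ε, hε, N, hN, h⟩ := exists_subgroup_fourierBound.{u, v} hp hT
  -- With this constant the claim is implied by the trivial bound 1 for orders up to `N`; the
  -- inductive step leaves it unchanged.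
  refine ⟨ε, hε, (N : ℝ) ^ ε, by positivity, fun E _ _ hE G _ _ => ?_⟩
  induction hm : Fintype.card G using Nat.strong_induction_on generalizing G with
  | _ m ih =>
  have hm0 : 0 < m := hm ▸ Fintype.card_pos
  have hm0' : (0 : ℝ) < m := by exact_mod_cast hm0
  rcases Nat.lt_or_ge N m with hNm | hNm
  · obtain ⟨K, _, _, φ, hφ, hK1, hK⟩ := h E hE G (hm ▸ hNm)
    have : Fintype (G ⧸ φ.range) := Fintype.ofFinite _
    have hcard : m = Fintype.card (G ⧸ φ.range) * Fintype.card K := by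
      rw [← hm, ← Nat.card_eq_fintype_card, AddSubgroup.card_eq_card_quotient_mul_card_addSubgroup
        φ.range, Nat.card_eq_fintype_card, ← Nat.card_congr (AddMonoidHom.ofInjective hφ).toEquiv,
        Nat.card_eq_fintype_card]
    have hQ0 : 0 < Fintype.card (G ⧸ φ.range) := Fintype.card_pos
    have hQ := ih (Fintype.card (G ⧸ φ.range)) (by rw [hcard]; exact lt_mul_of_one_lt_right hQ0 hK1)
      (G ⧸ φ.range) inferInstance _ rfl
    have := FourierBound.extension φ hφ (QuotientAddGroup.mk' φ.range)
      (QuotientAddGroup.mk'_surjective _) (fun x => by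
        rw [QuotientAddGroup.mk'_apply, QuotientAddGroup.eq_zero_iff]; rfl) hK hQ
    convert this using 1
    rw [hcard, Nat.cast_mul, Real.mul_rpow (by positivity) (by positivity)]
    ring
  · refine fourierBound_one.mono zero_le_one ?_
    rw [Real.rpow_neg hm0'.le, ← div_eq_mul_inv, one_le_div (by positivity)]
    gcongr

theorem corollary2p2 (𝓔 : BanachClass.{u}) (h𝓔 : 𝓔.IsTypeGtOne) :
    ∃ ε : ℝ, 0 < ε ∧ ∃ C : ℝ, 0 ≤ C ∧
      ∀ (G : Type v) [AddCommGroup G] [Fintype G]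
        (E : Type u) [NormedAddCommGroup E] [NormedSpace ℂ E] [CompleteSpace E],
        𝓔 E → ‖tensorOne (fourierMatrix G) E‖ ≤ C * (Fintype.card G : ℝ) ^ (-ε) := by
  obtain ⟨p, hp, T, hT, h⟩ := h𝓔
  obtain ⟨ε, hε, C, hC, hF⟩ := exists_fourierBound.{u, v} hp hT
  exact ⟨ε, hε, C, hC, fun G _ _ E _ _ _ hE => (hF E (h E hE) G).opNorm_le (by positivity)⟩
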